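/- Let $q\in\mathbf C^*$ with $|q|<1$, and write $c\equiv d$ for $c,d\in\mathbf C^*$ if $c/d\in q^{\mathbf Z}$. Let $\rho_1,\rho_2,\sigma_1,\sigma_2,x_1,x_2,x_3,x_4\in\mathbf C^*$ satisfy $\rho_1\not\equiv\rho_2$, $\sigma_1\not\equiv\sigma_2$, $x_k\not\equiv x_l$ for $k\neq l$, and the Fuchs relation $x_1x_2x_3x_4=\rho_1\rho_2/(\sigma_1\sigma_2)$. Put $R=\mathrm{Diag}(\rho_1,\rho_2)$ and $S=\mathrm{Diag}(\sigma_1,\sigma_2)$, and let $F$ be the set of all $2\times2$ matrices $M$ of holomorphic functions on $\mathbf C^*$ such that $M(qx)=R\,M(x)\,(Sx^2)^{-1}$, $\det M$ is not identically zero, and $\det M(x_k)=0$ for $k=1,\dots,4$. Let the group $D$ of invertible diagonal complex $2\times2$ matrices act on $F$ by $(\Gamma,\Delta)\cdot M=\Gamma M\Delta^{-1}$, $(\Gamma,\Delta)\in D\times D$ (this action factors through $H=(D\times D)/\mathbf C^*(I_2,I_2)$), and let $\mathcal F=F/H$ be the set of orbits. For a complex $2\times 2$ matrix $A=(a_{i,j})$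 of rank $1$, let $\rho(A)=[a_{1,1}:a_{1,2}]=[a_{2,1}:a_{2,2}]\in\mathbf P^1(\mathbf C)$, where an expression coming from a zero row is to be disregarded. Let $\mathbf C^*$ act on $\mathbf P^1(\mathbf C)$ by $c\cdot[a:b]=[ca:b]$ and diagonally on $(\mathbf P^1(\mathbf C))^4$. Then for every $M\in F$ the matrices $M(x_1),\dots,M(x_4)$ have rank $1$, so that $M\mapsto(\rho(M(x_1)),\dots,\rho(M(x_4)))$ is a well-defined map $F\to(\mathbf P^1(\mathbf C))^4$; and the map $[\rho]:\mathcal F\to(\mathbf P^1(\mathbf C))^4/\mathbf C^*$ that it induces is injective. In other words, if $M,N\in F$ and there is $c\in\mathbf C^*$ with $\rho(N(x_k))=c\cdot\rho(M(x_k))$ for $k=1,\dots,4$, then $N$ lies in the $H$-orbit of $M$. -/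

import Mathlib

open scoped LinearAlgebra.Projectivization

noncomputable section

namespace JimboSakai

/-- The relation `c ≡ d` on `ℂ*`: congruence modulo the subgroup `q^ℤ`. -/
def QCongr (q c d : ℂˣ) : Prop := c / d ∈ Subgroup.zpowers q

/-- The algebra `𝒪(ℂ*)` of holomorphic functions on the punctured plane. Its elements are honest
functions on `ℂˣ`, so that nothing is recorded at `0`. -/
def HolPunctured : Subalgebra ℂ (ℂˣ → ℂ) where
  carrier := {f | ∃ g : ℂ → ℂ, DifferentiableOn ℂ g {0}ᶜ ∧ ∀ z : ℂˣ, f z = g z}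
  mul_mem' := by
    rintro f₁ f₂ ⟨g₁, h₁, e₁⟩ ⟨g₂, h₂, e₂⟩
    exact ⟨fun z => g₁ z * g₂ z, h₁.mul h₂, fun z => by simp [e₁, e₂]⟩
  add_mem' := by
    rintro f₁ f₂ ⟨g₁, h₁, e₁⟩ ⟨g₂, h₂, e₂⟩
    exact ⟨fun z => g₁ z + g₂ z, h₁.add h₂, fun z => by simp [e₁, e₂]⟩
  algebraMap_mem' := fun c => ⟨fun _ => c, differentiableOn_const c, fun _ => rfl⟩

/-- `2 × 2` matrices of holomorphic functions on `ℂ*`. -/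
abbrev HolMatrix : Type := Matrix (Fin 2) (Fin 2) HolPunctured

/-- The value `M(z)` of a matrix of functions at a point `z` of `ℂ*`. -/
def valueAt (M : HolMatrix) (z : ℂˣ) : Matrix (Fin 2) (Fin 2) ℂ :=
  M.map fun f => (f : ℂˣ → ℂ) z

/-- `Diag(d₁, d₂)` as a constant complex matrix. -/
def cdiag (d : Fin 2 → ℂˣ) : Matrix (Fin 2) (Fin 2) ℂ :=
  Matrix.diagonal fun i => (d i : ℂ)

/-- `Diag(d₁, d₂)` as a matrix of (constant) holomorphic functions. -/
def hdiag (d : Fin 2 → ℂˣ) : HolMatrix :=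
  Matrix.diagonal fun i => algebraMap ℂ HolPunctured (d i : ℂ)

/-- The set `F`: matrices `M` with entries in `𝒪(ℂ*)` such that `M(qx) = R M(x) (S x²)⁻¹`, where
`R = Diag(ρ₁, ρ₂)` and `S = Diag(σ₁, σ₂)`, with `det M` not identically zero but vanishing at
the four points `x k`. -/
def F (q : ℂˣ) (ρ σ : Fin 2 → ℂˣ) (x : Fin 4 → ℂˣ) : Set HolMatrix :=
  {M | (∀ z : ℂˣ, valueAt M (q * z) = cdiag ρ * valueAt M z * ((z : ℂ) ^ 2 • cdiag σ)⁻¹) ∧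
    M.det ≠ 0 ∧ ∀ k, (M.det : ℂˣ → ℂ) (x k) = 0}

/-- The torus `D₂(ℂ) × D₂(ℂ)` of pairs of invertible diagonal matrices. -/
abbrev Torus : Type := (Fin 2 → ℂˣ) × (Fin 2 → ℂˣ)

lemma hdiag_one : hdiag 1 = 1 := by
  ext i j; fin_cases i <;> fin_cases j <;> simp [hdiag]

lemma hdiag_mul (d e : Fin 2 → ℂˣ) : hdiag (d * e) = hdiag d * hdiag e := by
  simp [hdiag, Matrix.diagonal_mul_diagonal]

lemma valueAt_apply (M : HolMatrix) (z : ℂˣ) (i j : Fin 2) :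
    valueAt M z i j = (M i j : ℂˣ → ℂ) z := rfl

lemma valueAt_torus (d e : Fin 2 → ℂˣ) (M : HolMatrix) (z : ℂˣ) :
    valueAt (hdiag d * M * hdiag e) z = cdiag d * valueAt M z * cdiag e := by
  ext i j
  simp [valueAt_apply, hdiag, cdiag]

lemma isUnit_det_hdiag (d : Fin 2 → ℂˣ) : IsUnit (hdiag d).det := by
  rw [← Matrix.isUnit_iff_isUnit_det]
  refine ⟨⟨hdiag d, hdiag d⁻¹, ?_, ?_⟩, rfl⟩ <;> rw [← hdiag_mul] <;> simp [hdiag_one]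

lemma cdiag_comm (d e : Fin 2 → ℂˣ) : cdiag d * cdiag e = cdiag e * cdiag d := by
  simp [cdiag, Matrix.diagonal_mul_diagonal, mul_comm]

lemma smul_cdiag_inv (w : ℂˣ) (d : Fin 2 → ℂˣ) :
    ((w : ℂ) ^ 2 • cdiag d)⁻¹ = cdiag fun i => (w ^ 2 * d i)⁻¹ := by
  apply Matrix.inv_eq_right_inv
  ext i j; fin_cases i <;> fin_cases j <;> simp [cdiag] <;> field_simp

lemma torus_mem {q : ℂˣ} {ρ σ : Fin 2 → ℂˣ} {x : Fin 4 → ℂˣ} (g : Torus) {M : HolMatrix}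
    (hM : M ∈ F q ρ σ x) : hdiag g.1 * M * hdiag g.2⁻¹ ∈ F q ρ σ x := by
  obtain ⟨h₁, h₂, h₃⟩ := hM
  refine ⟨fun z => ?_, ?_, fun k => ?_⟩
  · rw [valueAt_torus, valueAt_torus, h₁, smul_cdiag_inv]
    have e₁ := cdiag_comm g.1 ρ
    have e₂ := cdiag_comm g.2⁻¹ fun i => (z ^ 2 * σ i)⁻¹
    simp only [Matrix.mul_assoc] at *
    rw [← e₂, ← Matrix.mul_assoc, e₁, Matrix.mul_assoc]
  · rw [Matrix.det_mul, Matrix.det_mul]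
    intro h
    rw [(isUnit_det_hdiag _).mul_left_eq_zero, (isUnit_det_hdiag _).mul_right_eq_zero] at h
    exact h₂ h
  · rw [Matrix.det_mul, Matrix.det_mul]
    simp [h₃ k]

/-- The action `(Γ, Δ) • M = Γ M Δ⁻¹` of the torus on `F`. -/
instance torusAction (q : ℂˣ) (ρ σ : Fin 2 → ℂˣ) (x : Fin 4 → ℂˣ) :
    MulAction Torus (F q ρ σ x) where
  smul g M := ⟨hdiag g.1 * M.1 * hdiag g.2⁻¹, torus_mem g M.2⟩
  one_smul M := Subtype.ext <| by
    change hdiag 1 * M.1 * hdiag 1⁻¹ = M.1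
    simp [hdiag_one]
  mul_smul g g' M := Subtype.ext <| by
    change hdiag (g.1 * g'.1) * M.1 * hdiag (g.2 * g'.2)⁻¹ =
      hdiag g.1 * (hdiag g'.1 * M.1 * hdiag g'.2⁻¹) * hdiag g.2⁻¹
    rw [mul_inv_rev, hdiag_mul, hdiag_mul]
    simp only [Matrix.mul_assoc]

/-- The monodromy data space: the set of orbits of the torus in `F`. -/
abbrev FQuot (q : ℂˣ) (ρ σ : Fin 2 → ℂˣ) (x : Fin 4 → ℂˣ) : Type :=
  MulAction.orbitRel.Quotient Torus (F q ρ σ x)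

/-- The complex projective line, with homogeneous coordinates `[a : b]`. -/
def P1 : Type := ℙ ℂ (Fin 2 → ℂ)

/-- The linear map `(a, b) ↦ (c a, b)`. -/
def scaleFst (c : ℂˣ) : (Fin 2 → ℂ) →ₗ[ℂ] (Fin 2 → ℂ) where
  toFun v := ![(c : ℂ) * v 0, v 1]
  map_add' v w := by ext i; fin_cases i <;> simp [mul_add]
  map_smul' a v := by ext i; fin_cases i <;> simp [mul_left_comm]

lemma scaleFst_injective (c : ℂˣ) : Function.Injective (scaleFst c) := by
  intro v w h
  have h₀ := congrFun h 0
  have h₁ := congrFun h 1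
  ext i; fin_cases i <;> simp_all [scaleFst]

/-- The action `c • [a : b] = [c a : b]` of `ℂ*` on the projective line. -/
instance P1.mulAction : MulAction ℂˣ P1 where
  smul c p := Projectivization.map (scaleFst c) (scaleFst_injective c) p
  one_smul p := by
    change Projectivization.map (scaleFst 1) (scaleFst_injective 1) p = p
    induction p using Projectivization.ind with
    | h v hv =>
      rw [Projectivization.map_mk]
      congr 1
      ext i; fin_cases i <;> simp [scaleFst]
  mul_smul c d p := by
    change Projectivization.map (scaleFst (c * d)) (scaleFst_injective (c * d)) p =
      Projectivization.map (scaleFst c) (scaleFst_injective c)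
        (Projectivization.map (scaleFst d) (scaleFst_injective d) p)
    induction p using Projectivization.ind with
    | h v hv =>
      simp only [Projectivization.map_mk]
      congr 1
      ext i; fin_cases i <;> simp [scaleFst, mul_assoc]

/-- The set `(P¹)⁴ / ℂ*` of orbits of the diagonal action of `ℂ*`. -/
abbrev P1Quot : Type := MulAction.orbitRel.Quotient ℂˣ (Fin 4 → P1)

/-- `2 × 2` complex matrices of rank `1`. -/
abbrev RankOne : Type := {A : Matrix (Fin 2) (Fin 2) ℂ // A.rank = 1}

/-- The index of a non zero row. -/
def rowIdx (A : Matrix (Fin 2) (Fin 2) ℂ) : Fin 2 :=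
  open Classical in if A 0 = 0 then 1 else 0

lemma row_rowIdx_ne_zero (A : RankOne) : A.1 (rowIdx A.1) ≠ 0 := by
  obtain ⟨A, hA⟩ := A
  unfold rowIdx
  split_ifs with h
  · intro h'
    have : A = 0 := by
      ext i j; fin_cases i
      · simpa using congrFun h j
      · simpa using congrFun h' j
    simp [this] at hA
  · exact h

/-- The row ratio `[a₁₁ : a₁₂] = [a₂₁ : a₂₂]` of a matrix of rank `1`, an undefined member of the
equality being dismissed (see `rho_eq_mk`). -/
def rho (A : RankOne) : P1 := Projectivization.mk ℂ (A.1 (rowIdx A.1)) (row_rowIdx_ne_zero A)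

/-- Any non zero row of a matrix of rank `1` computes its row ratio. -/
lemma rho_eq_mk (A : RankOne) (i : Fin 2) (hi : A.1 i ≠ 0) :
    rho A = Projectivization.mk ℂ (A.1 i) hi := by
  obtain ⟨A, hA⟩ := A
  have hs : Module.finrank ℂ (Submodule.span ℂ (Set.range A)) = 1 := by
    rw [← hA, Matrix.rank_eq_finrank_span_row]; rfl
  have hmem : ∀ j, A j ∈ Submodule.span ℂ (Set.range A) := fun j =>
    Submodule.subset_span ⟨j, rfl⟩
  obtain ⟨c, hc⟩ := exists_smul_eq_of_finrank_eq_one hs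
    (x := ⟨A i, hmem i⟩) (by simpa [Subtype.ext_iff] using hi) ⟨_, hmem (rowIdx A)⟩
  exact (Projectivization.mk_eq_mk_iff' ℂ _ _ _ _).2 ⟨c, congrArg Subtype.val hc⟩

section maps

variable {q : ℂˣ} {ρ σ : Fin 2 → ℂˣ} {x : Fin 4 → ℂˣ}

/-- The map `(ρ₁, ρ₂, ρ₃, ρ₄) : F → (P¹)⁴`, `M ↦ (ρ(M(x₁)), …, ρ(M(x₄)))`, which makes sense
as soon as all the matrices `M(x k)` have rank `1`. -/
def rhoTuple (h : ∀ (M : F q ρ σ x) (k : Fin 4), (valueAt M.1 (x k)).rank = 1)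
    (M : F q ρ σ x) : Fin 4 → P1 :=
  fun k => rho ⟨valueAt M.1 (x k), h M k⟩

/-- `ρ_k(Γ M Δ⁻¹) = c • ρ_k(M)`, where `Δ = Diag(δ₁, δ₂)` and `c = δ₂ / δ₁`. -/
lemma rhoTuple_smul (h : ∀ (M : F q ρ σ x) (k : Fin 4), (valueAt M.1 (x k)).rank = 1)
    (g : Torus) (M : F q ρ σ x) :
    rhoTuple h (g • M) = (g.2 1 / g.2 0) • rhoTuple h M := by
  funext k
  have key : ∀ i j, valueAt (g • M).1 (x k) i j =
      g.1 i * valueAt M.1 (x k) i j * (g.2 j : ℂ)⁻¹ := by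
    intro i j
    change valueAt (hdiag g.1 * M.1 * hdiag g.2⁻¹) (x k) i j = _
    rw [valueAt_torus]
    simp [cdiag]
  set i := rowIdx (valueAt M.1 (x k))
  have hi : valueAt M.1 (x k) i ≠ 0 := row_rowIdx_ne_zero ⟨_, h M k⟩
  have hi' : valueAt (g • M).1 (x k) i ≠ 0 := by
    intro h0
    apply hi
    funext j
    have := congrFun h0 j
    rw [key] at this
    simpa using this
  change rho ⟨_, h (g • M) k⟩ = Projectivization.map (scaleFst (g.2 1 / g.2 0)) _ (rho _)
  rw [rho_eq_mk _ i hi', rho_eq_mk _ i hi, Projectivization.map_mk]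
  refine (Projectivization.mk_eq_mk_iff' ℂ _ _ _ _).2 ⟨g.1 i * (g.2 1 : ℂ)⁻¹, ?_⟩
  funext j
  change _ = valueAt (g • M).1 (x k) i j
  rw [key]
  fin_cases j <;> simp [scaleFst] <;> field_simp

/-- The induced map `[ρ]` from torus orbits in `F` to `(P¹)⁴ / ℂ*`. -/
def rhoQuot (h : ∀ (M : F q ρ σ x) (k : Fin 4), (valueAt M.1 (x k)).rank = 1) :
    FQuot q ρ σ x → P1Quot :=
  Quotient.map (rhoTuple h) <| by
    rintro M N ⟨g, rfl⟩
    exact ⟨g.2 1 / g.2 0, (rhoTuple_smul h g N).symm⟩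

end maps

end JimboSakai

end

namespace JimboSakai

open Filter Topology

/-! ### Fundamental annulus and quasi-periodic functions -/

/-! After replacing `M` by `M Δ⁻¹` for a suitable diagonal `Δ`, one may assume `ρ(M(x_k)) =
ρ(N(x_k))` for all `k`. On the points where `det M ≠ 0`, the matrix `N M⁻¹` satisfies `(N M⁻¹)(qz) =
R (N M⁻¹)(z) R⁻¹`, so the goal is to show that it is holomorphic, constant and diagonal.

To avoid poles, work with `N * M.adjugate = det M · N M⁻¹`. By the Fuchs relation its `(i, j)` entry
is multiplied by `(ρ i / ρ j) ∏ x_k / z⁴` under `z ↦ qz`. Equality of the row ratios makes it vanish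
at each `x_k`, hence on the four disjoint spirals `x_k q^ℤ`. The product `T` of the theta functions
`θ(z / x_k)` has simple zeros exactly there and multiplier `∏ x_k / z⁴`, so `T` divides every entry,
with a quotient of multiplier `ρ i / ρ j` (`exists_eq_mul_prod_thetaAt`). A holomorphic function on
`ℂ*` with constant multiplier `a` is constant if `a = 1` and zero if `a ∉ q^ℤ`
(`exists_eq_algebraMap_of_periodic`, `eq_zero_of_quasiperiodic`). Since `ρ₁ ≢ ρ₂`, this gives `N *
M.adjugate = Diag(c₁, c₂) T`. Likewise `det M = d T` with `d ≠ 0`, so `N = Diag(c₁/d, c₂/d) M`.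

The formula for `det M` also gives the rank: the zeros of `det M` at the `x_k` are simple, whereas
`M(x_k) = 0` would force a double zero. -/

lemma exists_zpow_mul_mem_annulus {q : ℂ} (hq0 : q ≠ 0) (hq : ‖q‖ < 1) {z : ℂ} (hz : z ≠ 0) :
    ∃ n : ℤ, ‖q‖ < ‖q ^ n * z‖ ∧ ‖q ^ n * z‖ ≤ 1 := by
  have hq0' : 0 < ‖q‖ := norm_pos_iff.2 hq0
  obtain ⟨n, h₁, h₂⟩ := exists_mem_Ioc_zpow (norm_pos_iff.2 hz) ((one_lt_inv₀ hq0').2 hq)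
  refine ⟨n + 1, ?_, ?_⟩
  · rw [norm_mul, norm_zpow, zpow_add_one₀ hq0'.ne', mul_right_comm]
    rw [inv_zpow, inv_lt_iff_one_lt_mul₀' (zpow_pos hq0' _)] at h₁
    exact lt_mul_of_one_lt_left hq0' h₁
  · rw [norm_mul, norm_zpow]
    rwa [inv_zpow, ← one_div, le_div_iff₀' (zpow_pos hq0' _)] at h₂

/-- Compactness gives a bound on `‖q‖ ≤ ‖z‖ ≤ 1`. It propagates inwards one annulus at a time
through `f z = μ * f (z / q)`, because `‖μ‖ ≤ 1`. -/
lemma bddAbove_norm_of_quasiperiodic {q μ : ℂ} (hq0 : q ≠ 0) (hq : ‖q‖ < 1) (hμ : ‖μ‖ ≤ 1)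
    {f : ℂ → ℂ} (hf : ContinuousOn f {0}ᶜ) (hfq : ∀ z, z ≠ 0 → f (q * z) = μ * f z) :
    ∃ C, ∀ z, z ≠ 0 → ‖z‖ ≤ 1 → ‖f z‖ ≤ C := by
  have hq0' : 0 < ‖q‖ := norm_pos_iff.2 hq0
  have hK : IsCompact (Metric.closedBall (0 : ℂ) 1 \ Metric.ball 0 ‖q‖) :=
    (isCompact_closedBall _ _).diff Metric.isOpen_ball
  obtain ⟨C, hC⟩ := hK.exists_bound_of_continuousOn (f := f) <| hf.mono <| by
    rintro z ⟨-, hz⟩ rfl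
    exact hz (by simpa using hq0)
  have key : ∀ n : ℕ, ∀ z, ‖q‖ ^ (n + 1) ≤ ‖z‖ → ‖z‖ ≤ 1 → ‖f z‖ ≤ C := by
    intro n
    induction n with
    | zero => exact fun z h₁ h₂ => hC z ⟨by simpa using h₂, by simpa using h₁⟩
    | succ n ih =>
      intro z h₁ h₂
      rcases le_or_gt ‖q‖ ‖z‖ with h | h
      · exact hC z ⟨by simpa using h₂, by simpa using h⟩
      · have hz : z ≠ 0 := norm_pos_iff.1 ((pow_pos hq0' _).trans_le h₁)
        have e := hfq (z / q) (div_ne_zero hz hq0)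
        rw [mul_div_cancel₀ _ hq0] at e
        have := ih (z / q) (by rwa [norm_div, le_div_iff₀ hq0', ← pow_succ])
          (by rw [norm_div, div_le_one₀ hq0']; exact h.le)
        rw [e, norm_mul]
        exact (mul_le_of_le_one_left (norm_nonneg _) hμ).trans this
  refine ⟨C, fun z hz hz1 => ?_⟩
  obtain ⟨n, hn⟩ := exists_pow_lt_of_lt_one (norm_pos_iff.2 hz) hq
  exact key n z ((pow_le_pow_of_le_one hq0'.le hq.le n.le_succ).trans hn.le) hz1

/-- A Liouville theorem without Laurent series. The bound `‖μ‖ ≤ 1` makes the singularity at `0`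
removable, so `f'` has a limit there. But `f'` has multiplier `μ / q`, of norm greater than `1`,
hence it would blow up along `qⁿ z` unless `f' z = 0`. -/
lemma eq_of_quasiperiodic {q μ : ℂ} (hq0 : q ≠ 0) (hq : ‖q‖ < 1) (hqμ : ‖q‖ < ‖μ‖)
    (hμ : ‖μ‖ ≤ 1) {f : ℂ → ℂ} (hf : DifferentiableOn ℂ f {0}ᶜ)
    (hfq : ∀ z, z ≠ 0 → f (q * z) = μ * f z) {z w : ℂ} (hz : z ≠ 0) (hw : w ≠ 0) :
    f z = f w := by
  have hq0' : 0 < ‖q‖ := norm_pos_iff.2 hq0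
  have ho : IsOpen ({0}ᶜ : Set ℂ) := isOpen_compl_singleton
  obtain ⟨C, hC⟩ := bddAbove_norm_of_quasiperiodic hq0 hq hμ hf.continuousOn hfq
  set G := Function.update f 0 (limUnder (𝓝[≠] 0) f)
  have hGd : DifferentiableOn ℂ G (Metric.ball 0 1) := by
    refine Complex.differentiableOn_update_limUnder_of_bddAbove (Metric.ball_mem_nhds _ one_pos)
      (hf.mono fun z hz => hz.2) ⟨C, ?_⟩
    rintro _ ⟨z, ⟨hz, hz0⟩, rfl⟩
    exact hC z hz0 (mem_ball_zero_iff.1 hz).le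
  have hGcont : ContinuousAt (deriv G) 0 :=
    (hGd.deriv Metric.isOpen_ball).continuousOn.continuousAt (Metric.ball_mem_nhds _ one_pos)
  have hder : ∀ z, z ≠ 0 → deriv f (q * z) = μ / q * deriv f z := by
    intro z hz
    have h₁ : HasDerivAt f (deriv f (q * z)) (q * z) :=
      (hf.differentiableAt (ho.mem_nhds (mul_ne_zero hq0 hz))).hasDerivAt
    have h₂ : HasDerivAt f (deriv f z) z := (hf.differentiableAt (ho.mem_nhds hz)).hasDerivAt
    have h₃ : HasDerivAt (fun z => f (q * z)) (deriv f (q * z) * q) z := by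
      have h := h₁.comp z ((hasDerivAt_id z).const_mul q)
      rw [mul_one] at h
      exact h
    have h₄ : HasDerivAt (fun z => f (q * z)) (μ * deriv f z) z :=
      (h₂.const_mul μ).congr_of_eventuallyEq
        (eventually_of_mem (ho.mem_nhds hz) fun y hy => hfq y hy)
    rw [div_mul_eq_mul_div, eq_div_iff hq0, h₃.unique h₄]
  have hzero : Set.EqOn (deriv f) 0 {0}ᶜ := by
    intro z hz
    have hz : z ≠ 0 := hz
    have hit : ∀ n : ℕ, deriv f (q ^ n * z) = (μ / q) ^ n * deriv f z := by
      intro n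
      induction n with
      | zero => simp
      | succ n ih => rw [pow_succ', mul_assoc, hder _ (by positivity), ih, pow_succ', mul_assoc]
    have hlim : Tendsto (fun n : ℕ => q ^ n * z) atTop (𝓝 0) := by
      simpa using (tendsto_pow_atTop_nhds_zero_of_norm_lt_one hq).mul_const z
    have h₁ : Tendsto (fun n : ℕ => (μ / q) ^ n * deriv f z) atTop (𝓝 (deriv G 0)) := by
      refine (hGcont.tendsto.comp hlim).congr fun n => ?_
      rw [← hit]
      refine EventuallyEq.deriv_eq (eventually_of_mem (ho.mem_nhds (x := q ^ n * z) ?_) ?_)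
      · exact mul_ne_zero (pow_ne_zero _ hq0) hz
      · exact fun y hy => Function.update_of_ne hy _ _
    by_contra hne
    have h₂ : Tendsto (fun n : ℕ => ‖(μ / q) ^ n * deriv f z‖) atTop atTop := by
      simp only [norm_mul, norm_pow, norm_div]
      exact (tendsto_pow_atTop_atTop_of_one_lt ((one_lt_div hq0').2 hqμ)).atTop_mul_const
        (norm_pos_iff.2 hne)
    exact not_tendsto_nhds_of_tendsto_atTop h₂ _ h₁.norm
  have hconn : IsPreconnected ({0}ᶜ : Set ℂ) :=
    (isConnected_compl_singleton_of_one_lt_rank (by simp) 0).isPreconnected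
  exact ho.is_const_of_deriv_eq_zero hconn hf hzero hz hw

/-! ### Division by a function with simple zeros -/

/-- Near a zero of `t`, the quotient `f / t` is the ratio of the difference quotients of `f` and
`t`. These are holomorphic, and the denominator takes the nonzero value `deriv t z` at the zero. -/
lemma exists_eq_mul_of_simple_zeros {U : Set ℂ} (hU : IsOpen U) {f t : ℂ → ℂ}
    (hf : DifferentiableOn ℂ f U) (ht : DifferentiableOn ℂ t U)
    (hsimple : ∀ z ∈ U, t z = 0 → deriv t z ≠ 0) (hft : ∀ z ∈ U, t z = 0 → f z = 0) :
    ∃ g : ℂ → ℂ, DifferentiableOn ℂ g U ∧ ∀ z ∈ U, f z = g z * t z := by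
  classical
  refine ⟨fun z => if t z = 0 then deriv f z / deriv t z else f z / t z, fun z hz => ?_,
    fun z hz => ?_⟩
  · have hUz := hU.mem_nhds hz
    apply DifferentiableAt.differentiableWithinAt
    by_cases h : t z = 0
    · have hf' := ((Complex.differentiableOn_dslope hUz).2 hf).differentiableAt hUz
      have ht' := ((Complex.differentiableOn_dslope hUz).2 ht).differentiableAt hUz
      have h0 : dslope t z z ≠ 0 := by rw [dslope_same]; exact hsimple z hz h
      refine (hf'.div ht' h0).congr_of_eventuallyEq ?_
      filter_upwards [ht'.continuousAt.eventually_ne h0] with y hy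
      rcases eq_or_ne y z with rfl | hyz
      · simp [h, dslope_same]
      · have hyz' : y - z ≠ 0 := sub_ne_zero.2 hyz
        have e₁ : t y = (y - z) * dslope t z y := by
          have := sub_smul_dslope t z y
          rw [h, sub_zero] at this
          exact this.symm
        have e₂ : f y = (y - z) * dslope f z y := by
          have := sub_smul_dslope f z y
          rw [hft z hz h, sub_zero] at this
          exact this.symm
        rw [if_neg (by rw [e₁]; exact mul_ne_zero hyz' hy), e₁, e₂, mul_div_mul_left _ _ hyz']
        rfl
    · have ht' := ht.differentiableAt hUz
      refine ((hf.differentiableAt hUz).div ht' h).congr_of_eventuallyEq ?_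
      filter_upwards [ht'.continuousAt.eventually_ne h] with y hy
      rw [if_neg hy]; rfl
  · by_cases h : t z = 0
    · simp [h, hft z hz h]
    · simp [h]

/-! ### The theta function -/

/-- The entire function `∏_{n ≥ 0} (1 - qⁿ z)`. -/
noncomputable def qPochhammer (q z : ℂ) : ℂ := ∏' n : ℕ, (1 + -(q ^ n * z))

lemma summable_norm_qPochhammer {q : ℂ} (hq : ‖q‖ < 1) (z : ℂ) :
    Summable fun n : ℕ => ‖-(q ^ n * z)‖ := by
  simpa using (summable_geometric_of_lt_one (norm_nonneg q) hq).mul_right ‖z‖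

lemma differentiable_qPochhammer {q : ℂ} (hq : ‖q‖ < 1) : Differentiable ℂ (qPochhammer q) := by
  intro z
  have hb : IsOpen (Metric.ball (0 : ℂ) (‖z‖ + 1)) := Metric.isOpen_ball
  refine DifferentiableOn.differentiableAt (s := Metric.ball 0 (‖z‖ + 1)) ?_
    (hb.mem_nhds (by simp))
  have h := Summable.hasProdLocallyUniformlyOn_nat_one_add (f := fun (n : ℕ) z => -(q ^ n * z)) hb
    ((summable_geometric_of_lt_one (norm_nonneg q) hq).mul_right (‖z‖ + 1))
    (.of_forall fun n y hy => ?_) (fun n => by fun_prop)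
  · refine h.differentiableOn (.of_forall fun s ↦ ?_) hb
    have : Differentiable ℂ fun z => ∏ n ∈ s, (1 + -(q ^ n * z)) :=
      Differentiable.fun_finsetProd fun n _ => by fun_prop
    exact this.differentiableOn
  · rw [norm_neg, norm_mul, norm_pow]
    have : ‖y‖ < ‖z‖ + 1 := by simpa using hy
    gcongr

lemma qPochhammer_eq {q : ℂ} (hq : ‖q‖ < 1) (z : ℂ) :
    qPochhammer q z = (1 - z) * qPochhammer q (q * z) := by
  have h := multipliable_one_add_of_summable (summable_norm_qPochhammer hq (q * z))
  unfold qPochhammer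
  rw [tprod_eq_zero_mul']
  · simp [pow_succ, mul_assoc, sub_eq_add_neg]
  · simpa [pow_succ, mul_assoc] using h

lemma qPochhammer_ne_zero {q : ℂ} (hq : ‖q‖ < 1) {z : ℂ} (hz : ‖z‖ < 1) :
    qPochhammer q z ≠ 0 := by
  refine tprod_one_add_ne_zero_of_summable (fun n h => ?_) (summable_norm_qPochhammer hq z)
  have h1 : q ^ n * z = 1 := (sub_eq_zero.1 (by rwa [sub_eq_add_neg])).symm
  have : ‖q ^ n * z‖ < 1 := by
    rw [norm_mul, norm_pow]
    exact mul_lt_one_of_nonneg_of_lt_one_right (pow_le_one₀ (norm_nonneg _) hq.le)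
      (norm_nonneg _) hz
  simp [h1] at this

/-- The theta function `∏_{n ≥ 0} (1 - qⁿ z) ∏_{n ≥ 1} (1 - qⁿ / z)`. -/
noncomputable def qTheta (q z : ℂ) : ℂ := qPochhammer q z * qPochhammer q (q / z)

lemma differentiableAt_qTheta {q : ℂ} (hq : ‖q‖ < 1) {z : ℂ} (hz : z ≠ 0) :
    DifferentiableAt ℂ (qTheta q) z := by
  have h := differentiable_qPochhammer hq
  exact (h z).mul ((h _).comp z ((differentiableAt_const q).div differentiableAt_id hz))

/-- The shift trades the factor `1 - z` for `1 - 1/z = -z⁻¹ (1 - z)`. -/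
lemma qTheta_mul {q : ℂ} (hq0 : q ≠ 0) (hq : ‖q‖ < 1) {z : ℂ} (hz : z ≠ 0) :
    qTheta q (q * z) = -z⁻¹ * qTheta q z := by
  have e : q * (1 / z) = q / z := by ring
  have e' : q / (q * z) = 1 / z := by field_simp
  rw [qTheta, qTheta, e', qPochhammer_eq hq (1 / z), qPochhammer_eq hq z, e]
  field_simp
  ring

/-- With `1 - z` split off, the remaining factors are values of `qPochhammer` at `q * z` and `q /
z`, both of norm less than `1` on this annulus. -/
lemma qTheta_annulus {q : ℂ} (hq : ‖q‖ < 1) {z : ℂ} (h₁ : ‖q‖ < ‖z‖)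
    (h₂ : ‖z‖ ≤ 1) (h : qTheta q z = 0) : z = 1 := by
  have hz : 0 < ‖z‖ := (norm_nonneg q).trans_lt h₁
  rw [qTheta, qPochhammer_eq hq, mul_assoc, mul_eq_zero, mul_eq_zero] at h
  rcases h with h | h | h
  · exact (sub_eq_zero.1 h).symm
  · refine absurd h (qPochhammer_ne_zero hq ?_)
    rw [norm_mul]
    exact (mul_le_of_le_one_right (norm_nonneg _) h₂).trans_lt hq
  · refine absurd h (qPochhammer_ne_zero hq ?_)
    rwa [norm_div, div_lt_one hz]

lemma qTheta_one {q : ℂ} (hq : ‖q‖ < 1) : qTheta q 1 = 0 := by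
  rw [qTheta, qPochhammer_eq hq]
  simp

lemma deriv_qTheta_one {q : ℂ} (hq : ‖q‖ < 1) : deriv (qTheta q) 1 ≠ 0 := by
  set u : ℂ → ℂ := fun z => qPochhammer q (q * z) * qPochhammer q (q / z)
  have hP := differentiable_qPochhammer hq
  have hu : DifferentiableAt ℂ u 1 :=
    ((hP _).comp 1 (differentiableAt_id.const_mul q)).mul
      ((hP _).comp 1 ((differentiableAt_const q).div differentiableAt_id one_ne_zero))
  have e : qTheta q = fun z => (1 - z) * u z := by
    funext z
    rw [qTheta, qPochhammer_eq hq, mul_assoc]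
  have h := ((hasDerivAt_id (1 : ℂ)).const_sub 1).mul hu.hasDerivAt
  have h' : deriv (qTheta q) 1 = -1 * u 1 + (1 - 1) * deriv u 1 := by
    rw [e]; exact h.deriv
  rw [h', sub_self, zero_mul, add_zero, neg_one_mul, neg_ne_zero]
  exact mul_ne_zero (qPochhammer_ne_zero hq (by simpa using hq))
    (qPochhammer_ne_zero hq (by simpa using hq))

lemma qTheta_zpow_mul_eq_zero_iff {q : ℂ} (hq0 : q ≠ 0) (hq : ‖q‖ < 1) {z : ℂ} (hz : z ≠ 0)
    (n : ℤ) : qTheta q (q ^ n * z) = 0 ↔ qTheta q z = 0 := by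
  have step : ∀ w, w ≠ 0 → (qTheta q (q * w) = 0 ↔ qTheta q w = 0) := by
    intro w hw
    rw [qTheta_mul hq0 hq hw]
    simp [hw]
  induction n with
  | zero => simp
  | succ n ih =>
    rw [add_comm, zpow_one_add₀ hq0, mul_assoc]
    exact (step _ (mul_ne_zero (zpow_ne_zero _ hq0) hz)).trans ih
  | pred n ih =>
    have h := step (q ^ (-(n : ℤ) - 1) * z) (mul_ne_zero (zpow_ne_zero _ hq0) hz)
    rw [← mul_assoc, ← zpow_one_add₀ hq0, add_sub_cancel] at h
    exact h.symm.trans ih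

lemma qTheta_eq_zero_iff {q : ℂ} (hq0 : q ≠ 0) (hq : ‖q‖ < 1) {z : ℂ} (hz : z ≠ 0) :
    qTheta q z = 0 ↔ ∃ n : ℤ, z = q ^ n := by
  constructor
  · intro h
    obtain ⟨n, h₁, h₂⟩ := exists_zpow_mul_mem_annulus hq0 hq hz
    have := qTheta_annulus hq h₁ h₂ ((qTheta_zpow_mul_eq_zero_iff hq0 hq hz n).2 h)
    refine ⟨-n, ?_⟩
    rw [zpow_neg]
    exact eq_inv_of_mul_eq_one_right this
  · rintro ⟨n, rfl⟩
    simpa using (qTheta_zpow_mul_eq_zero_iff hq0 hq one_ne_zero n).2 (qTheta_one hq)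

/-- Differentiate the functional equation; at a zero of theta the term coming from the derivative of
`-z⁻¹` drops out. This carries the simplicity of the zero `1` to every `qⁿ`. -/
lemma deriv_qTheta_mul_ne_zero_iff {q : ℂ} (hq0 : q ≠ 0) (hq : ‖q‖ < 1) {z : ℂ} (hz : z ≠ 0)
    (h : qTheta q z = 0) : deriv (qTheta q) (q * z) ≠ 0 ↔ deriv (qTheta q) z ≠ 0 := by
  have h₁ : HasDerivAt (fun z => qTheta q (q * z)) (deriv (qTheta q) (q * z) * q) z := by
    have h := ((differentiableAt_qTheta hq (mul_ne_zero hq0 hz)).hasDerivAt).comp z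
      ((hasDerivAt_id z).const_mul q)
    rw [mul_one] at h
    exact h
  have h₂ : HasDerivAt (fun z => qTheta q (q * z)) (-z⁻¹ * deriv (qTheta q) z) z := by
    have := ((hasDerivAt_inv hz).neg.mul (differentiableAt_qTheta hq hz).hasDerivAt)
    rw [h, mul_zero, zero_add] at this
    exact this.congr_of_eventuallyEq
      (eventually_of_mem (isOpen_compl_singleton.mem_nhds hz) fun y hy => qTheta_mul hq0 hq hy)
  have e := h₁.unique h₂
  rw [not_iff_not]
  constructor
  · intro h0
    rw [h0, zero_mul, eq_comm, mul_eq_zero] at e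
    exact e.resolve_left (by simpa using hz)
  · intro h0
    rw [h0, mul_zero, mul_eq_zero] at e
    exact e.resolve_right hq0

lemma deriv_qTheta_ne_zero {q : ℂ} (hq0 : q ≠ 0) (hq : ‖q‖ < 1) {z : ℂ} (hz : z ≠ 0)
    (h : qTheta q z = 0) : deriv (qTheta q) z ≠ 0 := by
  obtain ⟨n, rfl⟩ := (qTheta_eq_zero_iff hq0 hq hz).1 h
  clear h hz
  have hz (n : ℤ) : q ^ n ≠ 0 := zpow_ne_zero n hq0
  have h0 (n : ℤ) : qTheta q (q ^ n) = 0 := (qTheta_eq_zero_iff hq0 hq (hz n)).2 ⟨n, rfl⟩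
  induction n with
  | zero => simpa using deriv_qTheta_one hq
  | succ n ih =>
    rwa [add_comm, zpow_one_add₀ hq0, deriv_qTheta_mul_ne_zero_iff hq0 hq (hz _) (h0 _)]
  | pred n ih =>
    rwa [← deriv_qTheta_mul_ne_zero_iff hq0 hq (hz _) (h0 _), ← zpow_one_add₀ hq0, add_sub_cancel]

/-! ### The ring of holomorphic functions on the punctured plane -/

/-- Evaluation at a point of the punctured plane. -/
def evalAt (z : ℂˣ) : HolPunctured →+* ℂ :=
  (Pi.evalRingHom (fun _ : ℂˣ => ℂ) z).comp HolPunctured.val.toRingHom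

lemma evalAt_apply (z : ℂˣ) (f : HolPunctured) : evalAt z f = (f : ℂˣ → ℂ) z := rfl

lemma hol_ext {f g : HolPunctured} (h : ∀ z, evalAt z f = evalAt z g) : f = g :=
  Subtype.ext (funext h)

lemma evalAt_algebraMap (z : ℂˣ) (c : ℂ) : evalAt z (algebraMap ℂ HolPunctured c) = c := rfl

lemma valueAt_eq_mapMatrix (M : HolMatrix) (z : ℂˣ) : valueAt M z = (evalAt z).mapMatrix M := rfl

/-- The identity theorem on the connected set `ℂ*`. It allows theta functions to be cancelled in
identities despite their zeros. -/
instance : NoZeroDivisors HolPunctured where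
  eq_zero_or_eq_zero_of_mul_eq_zero := by
    rintro ⟨f, F, hF, hf⟩ ⟨g, G, hG, hg⟩ h
    have ho : IsOpen ({0}ᶜ : Set ℂ) := isOpen_compl_singleton
    have hconn : IsPreconnected ({0}ᶜ : Set ℂ) :=
      (isConnected_compl_singleton_of_one_lt_rank (by simp) 0).isPreconnected
    have h' : ∀ z ∈ ({0}ᶜ : Set ℂ), F z * G z = 0 := by
      intro z hz
      have := congrFun (congrArg Subtype.val h) (Units.mk0 z hz)
      change f _ * g _ = 0 at this
      rwa [hf, hg] at this
    refine ((hF.analyticOnNhd ho).eq_zero_or_eq_zero_of_mul_eq_zero (hG.analyticOnNhd ho) h'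
      hconn).imp (fun H => hol_ext fun z => ?_) fun H => hol_ext fun z => ?_
    · exact (hf z).trans (H z z.ne_zero)
    · exact (hg z).trans (H z z.ne_zero)

lemma exists_eq_algebraMap_of_quasiperiodic {q μ : ℂˣ} (hqμ : ‖(q : ℂ)‖ < ‖(μ : ℂ)‖)
    (hμ : ‖(μ : ℂ)‖ ≤ 1) (hq : ‖(q : ℂ)‖ < 1) {f : HolPunctured}
    (hf : ∀ z, evalAt (q * z) f = μ * evalAt z f) : ∃ c : ℂ, f = algebraMap ℂ HolPunctured c := by
  obtain ⟨f, F, hF, hfF⟩ := f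
  refine ⟨f 1, hol_ext fun z => ?_⟩
  have h := eq_of_quasiperiodic q.ne_zero hq hqμ hμ hF (fun z hz => by
    have := hf (Units.mk0 z hz)
    simpa [evalAt_apply, hfF] using this) z.ne_zero one_ne_zero
  change f z = f 1
  rw [hfF, hfF, h, Units.val_one]

lemma exists_eq_algebraMap_of_periodic {q : ℂˣ} (hq : ‖(q : ℂ)‖ < 1) {f : HolPunctured}
    (hf : ∀ z, evalAt (q * z) f = evalAt z f) : ∃ c : ℂ, f = algebraMap ℂ HolPunctured c :=
  exists_eq_algebraMap_of_quasiperiodic (μ := 1) (by simpa using hq) (by simp) hq (by simpa using hf)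

/-- The function `z ↦ zⁿ`. -/
noncomputable def holZpow (n : ℤ) : HolPunctured :=
  ⟨fun z => (z : ℂ) ^ n, fun z => z ^ n, fun _ hz =>
    (differentiableAt_zpow.2 (Or.inl hz)).differentiableWithinAt, fun _ => rfl⟩

lemma evalAt_holZpow (n : ℤ) (z : ℂˣ) : evalAt z (holZpow n) = (z : ℂ) ^ n := rfl

lemma eq_zero_of_quasiperiodic {q a : ℂˣ} (hq : ‖(q : ℂ)‖ < 1) (ha : a ∉ Subgroup.zpowers q)
    {f : HolPunctured} (hf : ∀ z, evalAt (q * z) f = a * evalAt z f) : f = 0 := by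
  -- Multiplying `f` by `zⁿ` changes the multiplier to `qⁿ a`, which is brought into the range where
  -- the Liouville theorem applies.
  obtain ⟨n, h₁, h₂⟩ := exists_zpow_mul_mem_annulus q.ne_zero hq a.ne_zero
  have hg : ∀ z, evalAt (q * z) (holZpow n * f) =
      (q ^ n * a : ℂˣ) * evalAt z (holZpow n * f) := by
    intro z
    simp only [map_mul, hf, evalAt_holZpow, Units.val_mul, mul_zpow, Units.val_zpow_eq_zpow_val]
    ring
  obtain ⟨c, hc⟩ := exists_eq_algebraMap_of_quasiperiodic (by simpa using h₁) (by simpa using h₂)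
    hq hg
  have h1 := hg 1
  rw [hc, evalAt_algebraMap, evalAt_algebraMap] at h1
  have hc0 : c = 0 := by
    by_contra h0
    -- A nonzero constant has multiplier `1`, which would put `a` in `q^ℤ`.
    have e : (q ^ n * a : ℂˣ) = 1 := Units.ext (mul_right_cancel₀ h0 (by simpa using h1.symm))
    refine ha ⟨-n, ?_⟩
    change q ^ (-n) = a
    rw [zpow_neg]
    exact inv_eq_of_mul_eq_one_right e
  refine hol_ext fun z => ?_
  have := congrArg (evalAt z) hc
  rw [hc0, map_zero, map_zero, map_mul, evalAt_holZpow, mul_eq_zero] at this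
  rw [map_zero]
  exact this.resolve_left (zpow_ne_zero _ z.ne_zero)

/-! ### Theta functions with prescribed spirals of zeros, and divisibility by them -/

lemma hasDerivAt_qTheta_div {q : ℂ} (hq : ‖q‖ < 1) {x z : ℂ} (hx : x ≠ 0) (hz : z ≠ 0) :
    HasDerivAt (fun z => qTheta q (z / x)) (deriv (qTheta q) (z / x) * (1 / x)) z :=
  HasDerivAt.comp (h₂ := qTheta q) (h := fun z => z / x) z
    (differentiableAt_qTheta hq (div_ne_zero hz hx)).hasDerivAt ((hasDerivAt_id z).div_const x)

/-- The theta function with simple zeros on the spiral `x q^ℤ`. -/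
noncomputable def thetaAt (q : ℂˣ) (hq : ‖(q : ℂ)‖ < 1) (x : ℂˣ) : HolPunctured :=
  ⟨fun z => qTheta q (z / x), fun z => qTheta q (z / x), fun _ hz =>
    (hasDerivAt_qTheta_div hq x.ne_zero hz).differentiableAt.differentiableWithinAt, fun _ => rfl⟩

lemma evalAt_thetaAt {q : ℂˣ} (hq : ‖(q : ℂ)‖ < 1) (x z : ℂˣ) :
    evalAt z (thetaAt q hq x) = qTheta q (z / x) := rfl

lemma evalAt_mul_thetaAt {q : ℂˣ} (hq : ‖(q : ℂ)‖ < 1) (x z : ℂˣ) :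
    evalAt (q * z) (thetaAt q hq x) = -(x * (z : ℂ)⁻¹) * evalAt z (thetaAt q hq x) := by
  rw [evalAt_thetaAt, evalAt_thetaAt, Units.val_mul, mul_div_assoc,
    qTheta_mul q.ne_zero hq (div_ne_zero z.ne_zero x.ne_zero), inv_div, div_eq_mul_inv]

lemma evalAt_thetaAt_eq_zero_iff {q : ℂˣ} (hq : ‖(q : ℂ)‖ < 1) (x z : ℂˣ) :
    evalAt z (thetaAt q hq x) = 0 ↔ QCongr q z x := by
  rw [evalAt_thetaAt, qTheta_eq_zero_iff q.ne_zero hq (div_ne_zero z.ne_zero x.ne_zero), QCongr,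
    Subgroup.mem_zpowers_iff]
  refine exists_congr fun n => ?_
  rw [eq_comm, Units.ext_iff]
  simp

lemma thetaAt_dvd {q : ℂˣ} (hq : ‖(q : ℂ)‖ < 1) (x : ℂˣ) {f : HolPunctured}
    (hf : ∀ z, QCongr q z x → evalAt z f = 0) : thetaAt q hq x ∣ f := by
  obtain ⟨f, F, hF, hfF⟩ := f
  obtain ⟨g, hg, h⟩ := exists_eq_mul_of_simple_zeros isOpen_compl_singleton hF
    (t := fun z => qTheta q (z / x)) (fun z hz => (hasDerivAt_qTheta_div hq x.ne_zero hz).differentiableAt.differentiableWithinAt)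
    (fun z hz h0 => by
      rw [(hasDerivAt_qTheta_div hq x.ne_zero hz).deriv]
      exact mul_ne_zero (deriv_qTheta_ne_zero q.ne_zero hq (div_ne_zero hz x.ne_zero) h0)
        (one_div_ne_zero x.ne_zero))
    (fun z hz h0 => (hfF (Units.mk0 z hz)).symm.trans <| hf (Units.mk0 z hz) <|
      (evalAt_thetaAt_eq_zero_iff hq x (Units.mk0 z hz)).1 h0)
  refine ⟨⟨fun z => g z, g, hg, fun _ => rfl⟩, hol_ext fun z => ?_⟩
  rw [map_mul, mul_comm]
  exact (hfF z).trans (h z z.ne_zero)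

section product

variable {ι : Type*} {q : ℂˣ} {x : ι → ℂˣ}

lemma prod_thetaAt_dvd (hq : ‖(q : ℂ)‖ < 1) (hx : ∀ k l, k ≠ l → ¬ QCongr q (x k) (x l))
    (s : Finset ι) {f : HolPunctured} (hf : ∀ k ∈ s, ∀ z, QCongr q z (x k) → evalAt z f = 0) :
    ∏ k ∈ s, thetaAt q hq (x k) ∣ f := by
  classical
  induction s using Finset.induction_on generalizing f with
  | empty => simp
  | insert a s has ih =>
    obtain ⟨g, rfl⟩ := thetaAt_dvd hq (x a) (hf a (Finset.mem_insert_self a s))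
    rw [Finset.prod_insert has]
    refine mul_dvd_mul_left _ (ih fun k hk z hz => ?_)
    have h := hf k (Finset.mem_insert_of_mem hk) z hz
    rw [map_mul, mul_eq_zero, evalAt_thetaAt_eq_zero_iff] at h
    -- The spirals are disjoint, so the factor at `a` has no zero on that of `k`, and the cofactor
    -- `g` must vanish there.
    refine h.resolve_left fun h' => hx k a (by rintro rfl; exact has hk) ?_
    have := div_mem h' hz
    rwa [div_div_div_cancel_left] at this

lemma evalAt_mul_prod_thetaAt (hq : ‖(q : ℂ)‖ < 1) (s : Finset ι) (z : ℂˣ) :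
    evalAt (q * z) (∏ k ∈ s, thetaAt q hq (x k)) =
      (∏ k ∈ s, -((x k : ℂ) * (z : ℂ)⁻¹)) * evalAt z (∏ k ∈ s, thetaAt q hq (x k)) := by
  rw [map_prod, map_prod, ← Finset.prod_mul_distrib]
  exact Finset.prod_congr rfl fun k _ => evalAt_mul_thetaAt hq (x k) z

end product

/-- Zeros spread in both directions along a spiral; going from `qz` back to `z` needs the multiplier
to be nonzero. -/
lemma evalAt_eq_zero_of_qcongr {q : ℂˣ} {f : HolPunctured} {u : ℂˣ → ℂ} (hu : ∀ z, u z ≠ 0)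
    (hf : ∀ z, evalAt (q * z) f = u z * evalAt z f) {x z : ℂˣ} (hx : evalAt x f = 0)
    (hz : QCongr q z x) : evalAt z f = 0 := by
  obtain ⟨n, hn⟩ := Subgroup.mem_zpowers_iff.1 hz
  obtain rfl : z = q ^ n * x := by rw [hn, div_mul_cancel]
  clear hz hn
  induction n with
  | zero => simpa using hx
  | succ n ih => rw [add_comm, zpow_one_add, mul_assoc, hf, ih, mul_zero]
  | pred n ih =>
    have h := hf (q ^ (-(n : ℤ) - 1) * x)
    rw [← mul_assoc, ← zpow_one_add, add_sub_cancel, ih, eq_comm, mul_eq_zero] at h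
    exact h.resolve_left (hu _)

/-! ### Matrices of rank one -/

lemma rank_pos_of_ne_zero {A : Matrix (Fin 2) (Fin 2) ℂ} (hA : A ≠ 0) : 0 < A.rank := by
  refine Nat.pos_of_ne_zero fun h => hA ?_
  rw [Matrix.rank, Submodule.finrank_eq_zero, LinearMap.range_eq_bot] at h
  exact (Matrix.toLin' (R := ℂ)).injective (h.trans (map_zero _).symm)

lemma rank_eq_one_of_det_eq_zero {A : Matrix (Fin 2) (Fin 2) ℂ} (hA : A ≠ 0) (hdet : A.det = 0) :
    A.rank = 1 := by
  -- In size `2` the adjugate is an involution. Thus `A` and its adjugate both have positive rank,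
  -- and their ranks add up to at most `2`.
  have hadj : A.adjugate ≠ 0 := fun h => hA <| by
    have e := Matrix.adjugate_adjugate A (by simp)
    rw [h, Matrix.adjugate_zero, Fintype.card_fin, Nat.sub_self, pow_zero, one_smul] at e
    exact e.symm
  have h := Matrix.rank_add_rank_le_card_of_mul_eq_zero (A := A) (B := A.adjugate)
    (by rw [Matrix.mul_adjugate, hdet, zero_smul])
  rw [Fintype.card_fin] at h
  have := rank_pos_of_ne_zero hA
  have := rank_pos_of_ne_zero hadj
  omega

lemma mul_adjugate_eq_zero_of_rho_eq {A B : RankOne} (h : rho A = rho B) :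
    B.1 * A.1.adjugate = 0 := by
  -- Each row of `A` is parallel to each row of `B`; the entries of `B * adj A` are, up to sign, the
  -- minors formed from such pairs.
  have key : ∀ i j, A.1 i 0 * B.1 j 1 = A.1 i 1 * B.1 j 0 := by
    intro i j
    by_cases hi : A.1 i = 0
    · simp [hi]
    by_cases hj : B.1 j = 0
    · simp [hj]
    rw [rho_eq_mk A i hi, rho_eq_mk B j hj] at h
    obtain ⟨c, hc⟩ := (Projectivization.mk_eq_mk_iff' ℂ _ _ _ _).1 h
    rw [← hc]
    simp only [Pi.smul_apply, smul_eq_mul]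
    ring
  ext i j
  rw [Matrix.adjugate_fin_two, Matrix.mul_apply, Fin.sum_univ_two]
  fin_cases j
  · simp only [Fin.zero_eta, Matrix.of_apply, Matrix.cons_val', Matrix.cons_val_zero,
      Matrix.cons_val_one, Matrix.cons_val_fin_one, Matrix.zero_apply]
    linear_combination -key 1 i
  · simp only [Fin.mk_one, Matrix.of_apply, Matrix.cons_val', Matrix.cons_val_zero,
      Matrix.cons_val_one, Matrix.cons_val_fin_one, Matrix.zero_apply]
    linear_combination key 0 i

/-! ### Elements of `F`: rank at the points `x k`, and comparison of two elements -/

section main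

variable {q : ℂˣ} {ρ σ : Fin 2 → ℂˣ} {x : Fin 4 → ℂˣ}

lemma evalAt_mul_apply {M : HolMatrix} (hM : M ∈ F q ρ σ x) (z : ℂˣ) (i j : Fin 2) :
    evalAt (q * z) (M i j) = ρ i * evalAt z (M i j) * ((z : ℂ) ^ 2 * σ j)⁻¹ := by
  have h := congrFun (congrFun (hM.1 z) i) j
  rw [smul_cdiag_inv] at h
  simpa [cdiag, valueAt_apply, evalAt_apply] using h

/-- The factors `S` cancel in `N M⁻¹`, and `det M` contributes `ρ₁ρ₂ / (σ₁σ₂ z⁴)`. The Fuchs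
relation turns this into the multiplier of the product of the four theta functions. -/
lemma evalAt_mul_mul_adjugate (hFR : ∏ k, x k = (∏ i, ρ i) / ∏ i, σ i) {M N : HolMatrix}
    (hM : M ∈ F q ρ σ x) (hN : N ∈ F q ρ σ x) (z : ℂˣ) (i j : Fin 2) :
    evalAt (q * z) ((N * M.adjugate) i j) =
      (ρ i / ρ j : ℂˣ) * ((∏ k, (x k : ℂ)) * ((z : ℂ) ^ 4)⁻¹) *
        evalAt z ((N * M.adjugate) i j) := by
  have hx : ∏ k, (x k : ℂ) = (∏ i, (ρ i : ℂ)) / ∏ i, (σ i : ℂ) := by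
    have := congrArg (Units.val) hFR
    simpa using this
  rw [hx, Matrix.adjugate_fin_two, Matrix.mul_apply]
  simp only [Fin.sum_univ_two, Fin.prod_univ_two]
  fin_cases j <;>
  · simp [evalAt_mul_apply hM, evalAt_mul_apply hN]
    field_simp

/-- The function `z ↦ f (q z)`. -/
def dilate (q : ℂˣ) (f : HolPunctured) : HolPunctured :=
  ⟨fun z => evalAt (q * z) f, by
    obtain ⟨f, F, hF, hfF⟩ := f
    refine ⟨fun z => F (q * z), hF.comp (by fun_prop) fun z hz => ?_, fun z => hfF (q * z)⟩
    exact mul_ne_zero q.ne_zero hz⟩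

lemma evalAt_dilate (z : ℂˣ) (f : HolPunctured) : evalAt z (dilate q f) = evalAt (q * z) f := rfl

lemma evalAt_mul_of_mul_prod_thetaAt (hq : ‖(q : ℂ)‖ < 1) {a : ℂ} {g : HolPunctured}
    (hT : ∏ k, thetaAt q hq (x k) ≠ 0)
    (h : ∀ z : ℂˣ, evalAt (q * z) (g * ∏ k, thetaAt q hq (x k)) =
      a * ((∏ k, (x k : ℂ)) * ((z : ℂ) ^ 4)⁻¹) * evalAt z (g * ∏ k, thetaAt q hq (x k)))
    (z : ℂˣ) : evalAt (q * z) g = a * evalAt z g := by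
  have key : dilate q g = algebraMap ℂ HolPunctured a * g := by
    refine mul_right_cancel₀ hT (hol_ext fun z => ?_)
    have h₁ := h z
    rw [map_mul, map_mul, evalAt_mul_prod_thetaAt] at h₁
    have e : ∏ k, -((x k : ℂ) * (z : ℂ)⁻¹) = (∏ k, (x k : ℂ)) * ((z : ℂ) ^ 4)⁻¹ := by
      simp only [Fin.prod_univ_four]
      field_simp
    have h0 : (∏ k, (x k : ℂ)) * ((z : ℂ) ^ 4)⁻¹ ≠ 0 :=
      mul_ne_zero (Finset.prod_ne_zero_iff.2 fun k _ => (x k).ne_zero)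
        (inv_ne_zero (pow_ne_zero _ z.ne_zero))
    rw [e] at h₁
    rw [map_mul, map_mul, map_mul, evalAt_dilate, evalAt_algebraMap]
    refine mul_left_cancel₀ h0 ?_
    linear_combination h₁
  rw [← evalAt_dilate, key, map_mul, evalAt_algebraMap]

lemma det_evalAt (M : HolMatrix) (z : ℂˣ) : (valueAt M z).det = evalAt z M.det := by
  rw [valueAt_eq_mapMatrix, ← RingHom.map_det]

lemma mul_adjugate_evalAt (M N : HolMatrix) (z : ℂˣ) (i j : Fin 2) :
    evalAt z ((N * M.adjugate) i j) = (valueAt N z * (valueAt M z).adjugate) i j := by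
  rw [valueAt_eq_mapMatrix, valueAt_eq_mapMatrix, ← RingHom.map_adjugate, ← map_mul]
  rfl

lemma evalAt_mul_det (hFR : ∏ k, x k = (∏ i, ρ i) / ∏ i, σ i) {M : HolMatrix}
    (hM : M ∈ F q ρ σ x) (z : ℂˣ) :
    evalAt (q * z) M.det = 1 * ((∏ k, (x k : ℂ)) * ((z : ℂ) ^ 4)⁻¹) * evalAt z M.det := by
  -- The case `N = M`, since `M * M.adjugate` is `det M` times the identity.
  have h := evalAt_mul_mul_adjugate hFR hM hM z 0 0
  simpa [Matrix.mul_adjugate] using h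

lemma multiplier_ne_zero (x : Fin 4 → ℂˣ) (a z : ℂˣ) :
    (a : ℂ) * ((∏ k, (x k : ℂ)) * ((z : ℂ) ^ 4)⁻¹) ≠ 0 :=
  mul_ne_zero a.ne_zero (mul_ne_zero (Finset.prod_ne_zero_iff.2 fun k _ => (x k).ne_zero)
    (inv_ne_zero (pow_ne_zero _ z.ne_zero)))

lemma exists_eq_mul_prod_thetaAt (hq : ‖(q : ℂ)‖ < 1)
    (hx : ∀ k l, k ≠ l → ¬ QCongr q (x k) (x l)) {f : HolPunctured} {a : ℂˣ}
    (hf : ∀ z : ℂˣ, evalAt (q * z) f =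
      a * ((∏ k, (x k : ℂ)) * ((z : ℂ) ^ 4)⁻¹) * evalAt z f)
    (h0 : ∀ k, evalAt (x k) f = 0) (hT : ∏ k, thetaAt q hq (x k) ≠ 0) :
    ∃ g : HolPunctured, f = g * ∏ k, thetaAt q hq (x k) ∧
      ∀ z, evalAt (q * z) g = a * evalAt z g := by
  obtain ⟨g, hg⟩ := prod_thetaAt_dvd hq hx Finset.univ fun k _ z hz =>
    evalAt_eq_zero_of_qcongr (multiplier_ne_zero x a) hf (h0 k) hz
  rw [mul_comm] at hg
  subst hg
  exact ⟨g, rfl, evalAt_mul_of_mul_prod_thetaAt hq hT hf⟩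

/-- The product divides `det M`, which is not identically zero. -/
lemma prod_thetaAt_ne_zero (hq : ‖(q : ℂ)‖ < 1)
    (hx : ∀ k l, k ≠ l → ¬ QCongr q (x k) (x l))
    (hFR : ∏ k, x k = (∏ i, ρ i) / ∏ i, σ i) {M : HolMatrix} (hM : M ∈ F q ρ σ x) :
    ∏ k, thetaAt q hq (x k) ≠ 0 := by
  intro h
  have hd := prod_thetaAt_dvd hq hx Finset.univ (f := M.det) fun k _ z hz =>
    evalAt_eq_zero_of_qcongr (fun z => multiplier_ne_zero x 1 z)
      (by simpa using evalAt_mul_det hFR hM) (hM.2.2 k) hz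
  rw [h, zero_dvd_iff] at hd
  exact hM.2.1 hd

/-- The determinant of an element of `F` is a multiple of the product of four theta functions. -/
lemma exists_det_eq (hq : ‖(q : ℂ)‖ < 1) (hx : ∀ k l, k ≠ l → ¬ QCongr q (x k) (x l))
    (hFR : ∏ k, x k = (∏ i, ρ i) / ∏ i, σ i) {M : HolMatrix} (hM : M ∈ F q ρ σ x) :
    ∃ d : ℂˣ, M.det = algebraMap ℂ HolPunctured d * ∏ k, thetaAt q hq (x k) := by
  obtain ⟨g, hg, hgq⟩ := exists_eq_mul_prod_thetaAt hq hx (f := M.det) (a := 1)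
    (by simpa using evalAt_mul_det hFR hM) hM.2.2 (prod_thetaAt_ne_zero hq hx hFR hM)
  obtain ⟨d, rfl⟩ := exists_eq_algebraMap_of_periodic hq (by simpa using hgq)
  have hd : d ≠ 0 := by
    rintro rfl
    rw [map_zero, zero_mul] at hg
    exact hM.2.1 hg
  exact ⟨Units.mk0 d hd, hg⟩

lemma valueAt_ne_zero (hq : ‖(q : ℂ)‖ < 1) (hx : ∀ k l, k ≠ l → ¬ QCongr q (x k) (x l))
    (hFR : ∏ k, x k = (∏ i, ρ i) / ∏ i, σ i) {M : HolMatrix} (hM : M ∈ F q ρ σ x) (k : Fin 4) :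
    valueAt M (x k) ≠ 0 := by
  intro h
  have hdvd : ∀ i j, thetaAt q hq (x k) ∣ M i j := fun i j =>
    thetaAt_dvd hq (x k) fun z hz =>
      evalAt_eq_zero_of_qcongr (u := fun z => ρ i * ((z : ℂ) ^ 2 * σ j)⁻¹) (fun z => by simp)
        (fun z => by rw [evalAt_mul_apply hM]; ring) (congrFun (congrFun h i) j) hz
  choose m hm using hdvd
  obtain ⟨d, hd⟩ := exists_det_eq hq hx hFR hM
  have hT := prod_thetaAt_ne_zero hq hx hFR hM
  rw [← Finset.mul_prod_erase _ _ (Finset.mem_univ k)] at hd hT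
  rw [Matrix.det_fin_two, hm 0 0, hm 0 1, hm 1 0, hm 1 1] at hd
  -- If `M` vanishes at `x k`, the theta factor at `x k` divides `det M` twice. Cancelling it once
  -- leaves a product of the other three that vanishes at `x k`, against the disjointness of the
  -- spirals.
  have e : thetaAt q hq (x k) * (m 0 0 * m 1 1 - m 0 1 * m 1 0) =
      algebraMap ℂ HolPunctured d * ∏ l ∈ Finset.univ.erase k, thetaAt q hq (x l) := by
    refine mul_left_cancel₀ (left_ne_zero_of_mul hT) ?_
    linear_combination hd
  have e' := congrArg (evalAt (x k)) e
  rw [map_mul, (evalAt_thetaAt_eq_zero_iff hq _ _).2 (by simp [QCongr, one_mem]), zero_mul,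
    map_mul, evalAt_algebraMap, map_prod, eq_comm, mul_eq_zero, Finset.prod_eq_zero_iff] at e'
  obtain ⟨l, hl, hl'⟩ := e'.resolve_left d.ne_zero
  exact hx k l (Finset.ne_of_mem_erase hl).symm ((evalAt_thetaAt_eq_zero_iff hq _ _).1 hl')

lemma rank_valueAt (hq : ‖(q : ℂ)‖ < 1) (hx : ∀ k l, k ≠ l → ¬ QCongr q (x k) (x l))
    (hFR : ∏ k, x k = (∏ i, ρ i) / ∏ i, σ i) {M : HolMatrix} (hM : M ∈ F q ρ σ x) (k : Fin 4) :
    (valueAt M (x k)).rank = 1 :=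
  rank_eq_one_of_det_eq_zero (valueAt_ne_zero hq hx hFR hM k) <| by
    rw [det_evalAt]; exact hM.2.2 k

lemma mem_orbit_of_rhoTuple_eq (hq : ‖(q : ℂ)‖ < 1)
    (hρ : ∀ i j, i ≠ j → ¬ QCongr q (ρ i) (ρ j))
    (hx : ∀ k l, k ≠ l → ¬ QCongr q (x k) (x l))
    (hFR : ∏ k, x k = (∏ i, ρ i) / ∏ i, σ i)
    (h : ∀ (M : F q ρ σ x) (k : Fin 4), (valueAt M.1 (x k)).rank = 1) {M N : F q ρ σ x}
    (hMN : ∀ k, rhoTuple h M k = rhoTuple h N k) : N ∈ MulAction.orbit Torus M := by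
  have hT := prod_thetaAt_ne_zero hq hx hFR M.2
  set T := ∏ k, thetaAt q hq (x k)
  have hE : ∀ i j, ∃ g : HolPunctured, (N.1 * M.1.adjugate) i j = g * T ∧
      ∀ z, evalAt (q * z) g = (ρ i / ρ j : ℂˣ) * evalAt z g := fun i j =>
    exists_eq_mul_prod_thetaAt hq hx (fun z => evalAt_mul_mul_adjugate hFR M.2 N.2 z i j)
      (fun k => by
        rw [mul_adjugate_evalAt]
        exact congrFun (congrFun (mul_adjugate_eq_zero_of_rho_eq (hMN k)) i) j) hT
  have hdiag : ∀ i, ∃ c : ℂ, (N.1 * M.1.adjugate) i i = algebraMap ℂ HolPunctured c * T := by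
    intro i
    obtain ⟨g, hg, hgq⟩ := hE i i
    obtain ⟨c, rfl⟩ := exists_eq_algebraMap_of_periodic hq (by simpa using hgq)
    exact ⟨c, hg⟩
  have hoff : ∀ i j, i ≠ j → (N.1 * M.1.adjugate) i j = 0 := by
    intro i j hij
    obtain ⟨g, hg, hgq⟩ := hE i j
    rw [hg, eq_zero_of_quasiperiodic hq (hρ i j hij) hgq, zero_mul]
  choose c hc using hdiag
  obtain ⟨d, hd⟩ := exists_det_eq hq hx hFR M.2
  have hNM : ∀ i j, algebraMap ℂ HolPunctured d * N.1 i j =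
      algebraMap ℂ HolPunctured (c i) * M.1 i j := by
    intro i j
    -- Compute `N * adj M * M` in two ways: it is `det M * N = d T N`, and also `Diag(c) T M`
    -- because `N * adj M` is diagonal.
    have e : (N.1 * M.1.adjugate * M.1) i j = M.1.det * N.1 i j := by
      rw [Matrix.mul_assoc, Matrix.adjugate_mul, Matrix.mul_smul, Matrix.mul_one]
      rfl
    rw [Matrix.mul_apply, Finset.sum_eq_single i (fun l _ hl => by rw [hoff i l hl.symm, zero_mul])
      (fun hi => absurd (Finset.mem_univ i) hi), hc, hd] at e
    refine mul_right_cancel₀ hT ?_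
    linear_combination -e
  have hd0 : algebraMap ℂ HolPunctured d ≠ 0 := fun h0 => d.ne_zero <| by
    rw [← evalAt_algebraMap 1 (d : ℂ), h0, map_zero]
  -- If `c i = 0`, row `i` of `N` vanishes and so does `det N`.
  have hc0 : ∀ i, c i ≠ 0 := by
    intro i hi
    refine N.2.2.1 (Matrix.det_eq_zero_of_row_eq_zero i fun j => ?_)
    have e := hNM i j
    rw [hi, map_zero, zero_mul, mul_eq_zero] at e
    exact e.resolve_left hd0
  refine ⟨(fun i => Units.mk0 (c i) (hc0 i) / d, 1), Subtype.ext ?_⟩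
  change hdiag (fun i => Units.mk0 (c i) (hc0 i) / d) * M.1 * hdiag 1⁻¹ = N.1
  rw [inv_one, hdiag_one, Matrix.mul_one]
  ext1 i j
  refine mul_left_cancel₀ hd0 ?_
  rw [hNM, JimboSakai.hdiag, Matrix.diagonal_mul, ← mul_assoc, ← map_mul]
  congr 2
  simp [mul_div_cancel₀]

end main

end JimboSakai

theorem mainTheorem8 (q : ℂˣ) (hq : ‖(q : ℂ)‖ < 1) (ρ σ : Fin 2 → ℂˣ) (x : Fin 4 → ℂˣ)
    (hρ : ∀ i j, i ≠ j → ¬ JimboSakai.QCongr q (ρ i) (ρ j))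
    (hσ : ∀ i j, i ≠ j → ¬ JimboSakai.QCongr q (σ i) (σ j))
    (hx : ∀ k l, k ≠ l → ¬ JimboSakai.QCongr q (x k) (x l))
    (hFR : (-1) ^ 4 * ∏ k, x k = (∏ i, ρ i) / ∏ i, σ i) :
    ∃ h : ∀ (M : JimboSakai.F q ρ σ x) (k : Fin 4),
        (JimboSakai.valueAt M.1 (x k)).rank = 1,
      Function.Injective (JimboSakai.rhoQuot h) ∧
      ∀ M N : JimboSakai.F q ρ σ x,
        (∃ c : ℂˣ, ∀ k, JimboSakai.rhoTuple h N k = c • JimboSakai.rhoTuple h M k) →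
        N ∈ MulAction.orbit JimboSakai.Torus M := by
  replace hFR : ∏ k, x k = (∏ i, ρ i) / ∏ i, σ i := by
    rwa [(by decide : Even 4).neg_one_pow, one_mul] at hFR
  have h : ∀ (M : JimboSakai.F q ρ σ x) (k : Fin 4), (JimboSakai.valueAt M.1 (x k)).rank = 1 :=
    fun M k => JimboSakai.rank_valueAt hq hx hFR M.2 k
  have key : ∀ M N : JimboSakai.F q ρ σ x,
      (∃ c : ℂˣ, ∀ k, JimboSakai.rhoTuple h N k = c • JimboSakai.rhoTuple h M k) →
      N ∈ MulAction.orbit JimboSakai.Torus M := by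
    rintro M N ⟨c, hc⟩
    -- Acting by `Δ = Diag(1, c)` multiplies the row ratios by `δ₂ / δ₁ = c`, so `g • M` and `N`
    -- have equal row ratios.
    let g : JimboSakai.Torus := (1, ![1, c])
    have hg := JimboSakai.rhoTuple_smul h g M
    have e : N ∈ MulAction.orbit JimboSakai.Torus (g • M) :=
      JimboSakai.mem_orbit_of_rhoTuple_eq hq hρ hx hFR h fun k => by
        rw [hg, hc]
        simp [g]
    rwa [MulAction.orbit_smul] at e
  refine ⟨h, ?_, key⟩
  intro a b
  induction a using Quotient.inductionOn with | _ M =>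
  induction b using Quotient.inductionOn with | _ N =>
  intro hab
  obtain ⟨c, hc⟩ := Quotient.exact hab
  exact Quotient.sound (key N M ⟨c, fun k => (congrFun hc k).symm⟩)
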